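/- Consider the nonlinear VAR($k$) model in dimension $p$, $$f_0(z_t)=c+\sum_{i=1}^k f_i(z_{t-i})+u_t ,$$ where $\{u_t\}$ is i.i.d. with density $\varrho$, $c\in\mathbb R^p$ and $f_i:\mathbb R^p\to\mathbb R^p$. Let $\mathscr F_0,\dots,\mathscr F_k$ be collections of functions $\mathbb R^p\to\mathbb R^p$ and $\mathscr R$ a collection of probability densities on $\mathbb R^p$. The parameter space consists of the points $(\tilde c,\{\tilde f_i\}_{i=0}^k,\tilde\varrho)$ with $\tilde c\in\mathbb R^p$, $\tilde f_i\in\mathscr F_i$ for $i=0,\dots,k$ and $\tilde\varrho\in\mathscr R$. Two points are called observationally equivalent if they imply the same conditional density of $z_t$ given $(z_{t-1},\dots,z_{t-k})$, that is, the same function $$(y,x_1,\dots,x_k)\mapsto \tilde\varrho\Big(\tilde f_0(y)-\tilde c-\sum_{i=1}^k\tilde f_i(x_i)\Big)\,\big|\det D\tilde f_0(y)\big| .$$ Suppose that 1. every $\tilde f_i\in\mathscr F_i$ is twice continuously differentiable with $\tilde f_i(0)=0$, for $i=0,\dots,k$; 2. every $\tilde f_0\in\mathscr F_0$ is a bijection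 $\mathbb R^p\to\mathbb R^p$ with $\det D\tilde f_0(z)>0$ for every $z\in\mathbb R^p$; 3. every $\tilde\varrho\in\mathscr R$ is continuously differentiable with support (the closure of $\{\tilde\varrho\neq0\}$) equal to $\mathbb R^p$, and $\int u\,\tilde\varrho(u)\,du=0$, $\int uu^{\mathsf T}\tilde\varrho(u)\,du=I_p$ (with absolutely convergent integrals). Let the true parameter point $(c,\{f_i\}_{i=0}^k,\varrho)$ belong to the parameter space and satisfy 4. the map $(z_1,\dots,z_k)\mapsto\sum_{i=1}^k f_i(z_i)$ is onto $\mathbb R^p$; 5. there are disjoint $\mathcal I_1,\mathcal I_2\subset\{1,\dots,k\}$ such that, for $j=1,2$, the Jacobian of $\{z_i\}_{i\in\mathcal I_j}\mapsto\sum_{i\in\mathcal I_j}f_i(z_i)$ has rank $p$ everywhere; 6. there are $u_0,\dots,u_p\in\mathbb R^p$ with $\varrho(u_i)>0$ for all $i$, such that $D(\log\varrho)(u_0)=0$ and the vectors $D(\log\varrho)(u_i)^{\mathsf T}$, $i=1,\dots,p$, span $\mathbb R^p$. Let $\tilde c\in\mathbb R^p$ and $\tilde f_i\in\mathscr F_i$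 for $i=0,\dots,k$, and consider the statements (A) there is a $\tilde\varrho\in\mathscr R$ such that $(\tilde c,\{\tilde f_i\}_{i=0}^k,\tilde\varrho)$ is observationally equivalent to $(c,\{f_i\}_{i=0}^k,\varrho)$; (B) there is an orthogonal matrix $\Upsilon\in\mathbb R^{p\times p}$ such that $\tilde c=\Upsilon c$ and $\tilde f_i(z)=\Upsilon f_i(z)$ for all $z\in\mathbb R^p$ and all $i\in\{0,\dots,k\}$. Then (A) implies (B). If moreover, for every orthogonal $\Upsilon$, the density $v\mapsto\varrho(\Upsilon^{\mathsf T}v)$ of $\Upsilon u_t$ belongs to $\mathscr R$, then (A) holds if and only if (B) holds. -/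

import Mathlib

open MeasureTheory

/-- A point `(c, (f₀, …, f_k), ϱ)` of the parameter space of the nonlinear VAR(`k`)
`f₀(z_t) = c + ∑_{i=1}^k f_i(z_{t-i}) + u_t` in dimension `p`, the shocks `u_t` being i.i.d.
with density `ϱ`. -/
structure NVARParam (p k : ℕ) where
  c : EuclideanSpace ℝ (Fin p)
  f : Fin (k + 1) → EuclideanSpace ℝ (Fin p) → EuclideanSpace ℝ (Fin p)
  den : EuclideanSpace ℝ (Fin p) → ℝ

namespace NVARParam

variable {p k : ℕ}

/-- The parameter space generated by function classes `F 0, …, F k` and a density class `R`. -/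
def space (F : Fin (k + 1) → Set (EuclideanSpace ℝ (Fin p) → EuclideanSpace ℝ (Fin p)))
    (R : Set (EuclideanSpace ℝ (Fin p) → ℝ)) : Set (NVARParam p k) :=
  {θ | (∀ i, θ.f i ∈ F i) ∧ θ.den ∈ R}

/-- The value `u = f₀(y) - c - ∑_{i=1}^k f_i(x_i)` of the shock for which `z_t = y` when the lags
are `z_{t-i} = x_i`; the lag `i ∈ {1, …, k}` is indexed by `i - 1 : Fin k`. -/
noncomputable def shock (θ : NVARParam p k) (x : Fin k → EuclideanSpace ℝ (Fin p))
    (y : EuclideanSpace ℝ (Fin p)) : EuclideanSpace ℝ (Fin p) :=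
  θ.f 0 y - θ.c - ∑ i : Fin k, θ.f i.succ (x i)

/-- The density at `y` of `z_t` conditional on `(z_{t-1}, …, z_{t-k}) = x`. -/
noncomputable def condDensity (θ : NVARParam p k) (x : Fin k → EuclideanSpace ℝ (Fin p))
    (y : EuclideanSpace ℝ (Fin p)) : ℝ :=
  θ.den (θ.shock x y) * |(fderiv ℝ (θ.f 0) y).det|

/-- Two parameter points are observationally equivalent if they imply the same conditional
density function of `z_t` given its `k` lags. -/
def ObsEquiv (θ₁ θ₂ : NVARParam p k) : Prop :=
  ∀ x y, θ₁.condDensity x y = θ₂.condDensity x y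

/-- `condDensity` is what it is called: if `u` has density `ϱ` and `z` solves the model equation
at the lags `x`, then `z` has density `condDensity x`. -/
theorem map_eq_withDensity_condDensity (θ : NVARParam p k) (hf : ContDiff ℝ 1 (θ.f 0))
    (hbij : Function.Bijective (θ.f 0))
    {Ω : Type*} [MeasurableSpace Ω] (P : Measure Ω) (u z : Ω → EuclideanSpace ℝ (Fin p))
    (x : Fin k → EuclideanSpace ℝ (Fin p)) (hu : Measurable u)
    (hlaw : P.map u = volume.withDensity (fun v => ENNReal.ofReal (θ.den v)))
    (hz : ∀ ω, θ.f 0 (z ω) = θ.c + ∑ i : Fin k, θ.f i.succ (x i) + u ω) :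
    P.map z = volume.withDensity (fun y => ENNReal.ofReal (θ.condDensity x y)) := by
  have hcont : Continuous (θ.shock x) :=
    (hf.continuous.sub continuous_const).sub continuous_const
  have hinj : Function.Injective (θ.shock x) := fun a b h => hbij.1 (by simpa [shock] using h)
  have hemb : MeasurableEmbedding (θ.shock x) := hcont.measurableEmbedding hinj
  have huz : ∀ ω, θ.shock x (z ω) = u ω := fun ω => by
    simp only [shock, hz ω]; abel
  have hzm : Measurable z := by
    rw [← hemb.measurable_comp_iff]
    have : θ.shock x ∘ z = u := funext huz
    rwa [this]
  have hder : ∀ y, HasFDerivAt (θ.shock x) (fderiv ℝ (θ.f 0) y) y := fun y =>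
    (((hf.differentiable one_ne_zero) y).hasFDerivAt.sub_const _).sub_const _
  ext s hs
  have hpre : z ⁻¹' s = u ⁻¹' (θ.shock x '' s) := by
    ext ω
    simp only [Set.mem_preimage, ← huz ω, hinj.mem_set_image]
  have hs' : MeasurableSet (θ.shock x '' s) := hemb.measurableSet_image.2 hs
  rw [Measure.map_apply hzm hs, hpre, ← Measure.map_apply hu hs', hlaw,
    withDensity_apply _ hs', withDensity_apply _ hs,
    lintegral_image_eq_lintegral_abs_det_fderiv_mul volume hs
      (fun y _ => (hder y).hasFDerivWithinAt) hinj.injOn]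
  refine lintegral_congr fun y => ?_
  rw [condDensity, mul_comm, ENNReal.ofReal_mul' (abs_nonneg _)]

end NVARParam

/-- A continuously differentiable probability density on `ℝ^p` with support `ℝ^p`, mean zero and
identity covariance matrix. -/
structure IsNormalisedDensity {p : ℕ} (ϱ : EuclideanSpace ℝ (Fin p) → ℝ) : Prop where
  nonneg : ∀ u, 0 ≤ ϱ u
  integrable : Integrable ϱ
  integral_eq_one : ∫ u, ϱ u = 1
  contDiff : ContDiff ℝ 1 ϱ
  support : closure {u | ϱ u ≠ 0} = Set.univ
  integrable_mean : ∀ i, Integrable (fun u => u i * ϱ u)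
  mean : ∀ i, ∫ u, u i * ϱ u = 0
  integrable_cov : ∀ i j, Integrable (fun u => u i * u j * ϱ u)
  cov : ∀ i j, ∫ u, u i * u j * ϱ u = (1 : Matrix (Fin p) (Fin p) ℝ) i j

/-- The Jacobian of `(z_i)_{i ∈ I} ↦ ∑_{i ∈ I} g_i(z_i)` has rank `p` everywhere. -/
def SumJacobianFullRank {p k : ℕ}
    (g : Fin k → EuclideanSpace ℝ (Fin p) → EuclideanSpace ℝ (Fin p)) (I : Finset (Fin k)) :
    Prop :=
  ∀ z : I → EuclideanSpace ℝ (Fin p),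
    Module.finrank ℝ (LinearMap.range
      (fderiv ℝ (fun w : I → EuclideanSpace ℝ (Fin p) => ∑ i : I, g i (w i)) z).toLinearMap) = p

/-- The score `D(log ϱ)(u)ᵀ` of a density (meaningful where `ϱ u > 0`). -/
noncomputable def score {p : ℕ} (ϱ : EuclideanSpace ℝ (Fin p) → ℝ)
    (u : EuclideanSpace ℝ (Fin p)) : EuclideanSpace ℝ (Fin p) :=
  gradient (fun v => Real.log (ϱ v)) u

/-! Write `G`, `G'` for the two sums of lag functions. A density with finite mean has no nonzero
period, so the conditional density determines the value of the lag sum: `G` and `G'` have the same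
level sets, and `G' = φ ∘ G` with `φ` injective. Each of two disjoint groups of lags can move `G`
locally in every direction; moving both at once shows that `φ` is additive near every point, hence
linear (`exists_clm_of_sum_factors`). Now fix `y`. The lags let the shock `u` take every value, so
equivalence reads `ϱ' (m + φ u) * J = ϱ u` with `m`, `J` depending on `y` only. Comparing moments of
order 0, 1 and 2 gives `m = 0` and `φ` orthogonal (`IsNormalisedDensity.eq_zero_of_affine`); `m = 0`
for all `y` relates the constants and the functions `f₀`. Conversely, a rotation of the model
rotates the shock and preserves the absolute Jacobian. -/

section

variable {p k : ℕ}

/-! ### Local sections of the lag sum -/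

/-- A continuously differentiable function whose derivative at a point is onto has a
differentiable local right inverse. -/
theorem HasStrictFDerivAt.exists_local_section {E G : Type*} [NormedAddCommGroup E]
    [NormedSpace ℝ E] [CompleteSpace E] [NormedAddCommGroup G] [NormedSpace ℝ G]
    [FiniteDimensional ℝ E] {h : G → E} {h' : G →L[ℝ] E} {z : G}
    (hh : HasStrictFDerivAt h h' z) (hs : Function.Surjective h') :
    ∃ γ : E → G, DifferentiableAt ℝ γ 0 ∧ γ 0 = z ∧ ∀ᶠ s in nhds 0, h (γ s) = h z + s := by
  -- On the slice `s ↦ z + L s`, with `L` a linear right inverse of `h'`, the derivative becomes the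
  -- identity and the inverse function theorem applies.
  obtain ⟨L, hL⟩ := h'.toLinearMap.exists_rightInverse_of_surjective
    (LinearMap.range_eq_top.2 hs)
  let Lc : E →L[ℝ] G := LinearMap.toContinuousLinearMap L
  have hLc : h'.comp Lc = ((ContinuousLinearEquiv.refl ℝ E : E ≃L[ℝ] E) : E →L[ℝ] E) := by
    ext s
    exact LinearMap.congr_fun hL s
  have hin : HasStrictFDerivAt (fun s : E => z + Lc s) Lc 0 :=
    Lc.hasStrictFDerivAt.const_add z
  have hψ : HasStrictFDerivAt (fun s : E => h (z + Lc s))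
      ((ContinuousLinearEquiv.refl ℝ E : E ≃L[ℝ] E) : E →L[ℝ] E) 0 := by
    rw [← hLc]
    refine HasStrictFDerivAt.comp (g := h) (0 : E) ?_ hin
    simpa using hh
  have h0 : h (z + Lc 0) = h z := by simp
  have hinv := hψ.to_localInverse
  have himg : hψ.localInverse _ _ _ (h z) = 0 := by
    have := hψ.localInverse_apply_image
    rwa [h0] at this
  rw [h0] at hinv
  have hright := hψ.eventually_right_inverse
  rw [h0] at hright
  refine ⟨fun s => z + Lc (hψ.localInverse _ _ _ (h z + s)), ?_, by simp [himg], ?_⟩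
  · have h1 : DifferentiableAt ℝ (fun s => hψ.localInverse _ _ _ (h z + s)) 0 := by
      have h2 : DifferentiableAt ℝ (hψ.localInverse _ _ _) (h z + 0) := by
        rw [add_zero]; exact hinv.hasFDerivAt.differentiableAt
      exact h2.comp (0 : E) (differentiableAt_id.const_add (h z))
    exact (Lc.differentiableAt.comp (0 : E) h1).const_add z
  · have ht : Filter.Tendsto (fun s : E => h z + s) (nhds 0) (nhds (h z)) := by
      have : Continuous fun s : E => h z + s := by fun_prop
      simpa using this.tendsto 0
    exact ht.eventually hright

/-- A full-rank partial Jacobian allows `∑ i, g i (x i)` to be moved freely, near any point, by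
changing only the coordinates in `I`. -/
theorem SumJacobianFullRank.exists_local_section
    {g : Fin k → EuclideanSpace ℝ (Fin p) → EuclideanSpace ℝ (Fin p)} {I : Finset (Fin k)}
    (hI : SumJacobianFullRank g I) (hg : ∀ i, ContDiff ℝ 1 (g i))
    (x : Fin k → EuclideanSpace ℝ (Fin p)) :
    ∃ γ : EuclideanSpace ℝ (Fin p) → Fin k → EuclideanSpace ℝ (Fin p),
      DifferentiableAt ℝ γ 0 ∧ (∀ s, ∀ i ∉ I, γ s i = x i) ∧
      ∀ᶠ s in nhds 0, ∑ i, g i (γ s i) = ∑ i, g i (x i) + s := by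
  set h : (I → EuclideanSpace ℝ (Fin p)) → EuclideanSpace ℝ (Fin p) :=
    fun w => ∑ i : I, g i (w i) with hh
  have hc : ContDiff ℝ 1 h :=
    ContDiff.sum fun i _ => (hg i).comp (contDiff_apply ℝ (EuclideanSpace ℝ (Fin p)) i)
  have hsurj : Function.Surjective (fderiv ℝ h fun i : I => x i) := by
    have := hI fun i : I => x i
    refine LinearMap.range_eq_top.1 (Submodule.eq_top_of_finrank_eq ?_)
    rw [this, finrank_euclideanSpace_fin]
  obtain ⟨γ, hγd, -, hγ⟩ :=
    (hc.contDiffAt.hasStrictFDerivAt one_ne_zero).exists_local_section hsurj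
  refine ⟨fun s i => if hi : i ∈ I then γ s ⟨i, hi⟩ else x i, ?_, ?_, ?_⟩
  · rw [differentiableAt_pi]
    intro i
    by_cases hi : i ∈ I
    · simpa [hi] using differentiableAt_pi.1 hγd ⟨i, hi⟩
    · simp [hi]
  · intro s i hi
    simp [hi]
  · filter_upwards [hγ] with s hs
    rw [← Finset.sum_add_sum_compl I, ← Finset.sum_add_sum_compl I (fun i => g i (x i)),
      ← Finset.sum_coe_sort I, ← Finset.sum_coe_sort I]
    have h2 : ∑ i ∈ Iᶜ, g i (if hi : i ∈ I then γ s ⟨i, hi⟩ else x i) = ∑ i ∈ Iᶜ, g i (x i) :=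
      Finset.sum_congr rfl fun i hi => by simp [Finset.mem_compl.1 hi]
    have h1 : ∑ i : I, g i (if hi : (i : Fin k) ∈ I then γ s ⟨i, hi⟩ else x i)
        = ∑ i : I, g i (x i) + s := by
      refine Eq.trans (Finset.sum_congr rfl fun i _ => ?_) hs
      simp
    rw [h1, h2]
    abel

/-! ### Linearity of the factor map -/

/-- A differentiable function that is additive near each point, and vanishes at the origin, is
linear. -/
theorem exists_clm_of_locally_additive {E G : Type*} [NormedAddCommGroup E] [NormedSpace ℝ E]
    [NormedAddCommGroup G] [NormedSpace ℝ G] {φ : E → G} (hφ : Differentiable ℝ φ) (h0 : φ 0 = 0)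
    (hadd : ∀ v, ∀ᶠ s in nhds (0 : E), ∀ᶠ t in nhds (0 : E),
      φ (v + s + t) = φ (v + s) + φ (v + t) - φ v) :
    ∃ A : E →L[ℝ] G, ∀ v, φ v = A v := by
  have hshift : ∀ v, fderiv ℝ (fun t => φ (v + t)) 0 = fderiv ℝ φ v := fun v => by
    rw [fderiv_comp_add_left, add_zero]
  -- For `w` near `v`, the germs of `φ (w + ·)` and `φ (v + ·)` at `0` differ by a constant, so
  -- their derivatives agree.
  have hloc : IsLocallyConstant (fderiv ℝ φ) := by
    rw [IsLocallyConstant.iff_eventually_eq]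
    intro v
    have ht : Filter.Tendsto (fun w : E => w - v) (nhds v) (nhds 0) := by
      have : Continuous fun w : E => w - v := by fun_prop
      simpa using this.tendsto v
    filter_upwards [ht.eventually (hadd v)] with w hw
    rw [add_sub_cancel] at hw
    rw [← hshift w, ← hshift v, Filter.EventuallyEq.fderiv_eq hw]
    simp only [add_sub_assoc]
    rw [fderiv_const_add, fderiv_sub_const]
  refine ⟨fderiv ℝ φ 0, fun v => ?_⟩
  have hd : ∀ x, fderiv ℝ (fun v => φ v - fderiv ℝ φ 0 v) x = 0 := fun x => by
    rw [fderiv_fun_sub (hφ x) (fderiv ℝ φ 0).differentiableAt, ContinuousLinearMap.fderiv,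
      hloc.apply_eq_of_preconnectedSpace x 0, sub_self]
  have := is_const_of_fderiv_eq_zero (𝕜 := ℝ)
    (hφ.sub (fderiv ℝ φ 0).differentiable) hd v 0
  simpa [h0, sub_eq_zero] using this

/-- If `∑ i, g' i (x i)` is a function of `∑ i, g i (x i)`, then it is a linear one, provided that
two disjoint groups of coordinates each have a full-rank Jacobian. -/
theorem exists_clm_of_sum_factors
    {g g' : Fin k → EuclideanSpace ℝ (Fin p) → EuclideanSpace ℝ (Fin p)}
    (hg : ∀ i, ContDiff ℝ 1 (g i)) (hg' : ∀ i, ContDiff ℝ 1 (g' i))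
    (hsurj : Function.Surjective
      (fun z : Fin k → EuclideanSpace ℝ (Fin p) => ∑ i : Fin k, g i (z i)))
    {I₁ I₂ : Finset (Fin k)} (hdisj : Disjoint I₁ I₂)
    (hI₁ : SumJacobianFullRank g I₁) (hI₂ : SumJacobianFullRank g I₂)
    {φ : EuclideanSpace ℝ (Fin p) → EuclideanSpace ℝ (Fin p)} (h0 : φ 0 = 0)
    (hφ : ∀ x : Fin k → EuclideanSpace ℝ (Fin p), φ (∑ i, g i (x i)) = ∑ i, g' i (x i)) :
    ∃ A : EuclideanSpace ℝ (Fin p) →L[ℝ] EuclideanSpace ℝ (Fin p), ∀ v, φ v = A v := by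
  refine exists_clm_of_locally_additive (fun v => ?_) h0 fun v => ?_
  -- Along a local section, `φ (v + s)` equals `∑ i, g' i (γ s i)`, which is differentiable in `s`.
  · obtain ⟨x, rfl⟩ := hsurj v
    obtain ⟨γ, hγd, -, hγ⟩ := hI₁.exists_local_section hg x
    have h1 : DifferentiableAt ℝ (fun s => ∑ i, g' i (γ s i)) 0 :=
      DifferentiableAt.fun_sum fun i _ =>
        (((hg' i).differentiable one_ne_zero) _).comp 0 (differentiableAt_pi.1 hγd i)
    have h2 : DifferentiableAt ℝ (fun s => φ (∑ i, g i (x i) + s)) 0 :=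
      h1.congr_of_eventuallyEq (by filter_upwards [hγ] with s hs; rw [← hs, hφ])
    have h3 : DifferentiableAt ℝ (fun w => w - ∑ i, g i (x i)) (∑ i, g i (x i)) := by fun_prop
    have h4 := DifferentiableAt.comp (g := fun s => φ (∑ i, g i (x i) + s))
      (∑ i, g i (x i)) (by simpa using h2) h3
    simpa [Function.comp_def] using h4
  · obtain ⟨x, rfl⟩ := hsurj v
    obtain ⟨γ₁, -, hx₁, hγ₁⟩ := hI₁.exists_local_section hg x
    obtain ⟨γ₂, -, hx₂, hγ₂⟩ := hI₂.exists_local_section hg x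
    filter_upwards [hγ₁] with s hs
    filter_upwards [hγ₂] with t ht
    -- The two displacements are superposed. They touch disjoint coordinates, so `hy` holds for
    -- every sum of functions of single coordinates, and is used for both `g` and `g'`.
    let y : Fin k → EuclideanSpace ℝ (Fin p) := fun i => if i ∈ I₂ then γ₂ t i else γ₁ s i
    have hy : ∀ q : Fin k → EuclideanSpace ℝ (Fin p) → EuclideanSpace ℝ (Fin p),
        ∑ i, q i (y i) = ∑ i, q i (γ₁ s i) + ∑ i, q i (γ₂ t i) - ∑ i, q i (x i) := fun q => by
      rw [← Finset.sum_add_distrib, ← Finset.sum_sub_distrib]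
      refine Finset.sum_congr rfl fun i _ => ?_
      by_cases hi : i ∈ I₂
      · simp [y, hi, hx₁ s i (Finset.disjoint_right.1 hdisj hi)]
      · simp [y, hi, hx₂ t i hi]
    have hgy := hy g
    rw [hs, ht] at hgy
    have : ∑ i, g i (x i) + s + t = ∑ i, g i (y i) := by rw [hgy]; abel
    rw [this, ← hs, ← ht, hφ, hφ, hφ, hφ, hy g']

/-! ### Moments of normalised densities -/

theorem IsNormalisedDensity.integral_add_linear {ϱ : EuclideanSpace ℝ (Fin p) → ℝ}
    (hϱ : IsNormalisedDensity ϱ) (m : ℝ) (a : Fin p → ℝ) :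
    ∫ u, (m + ∑ j, a j * u j) * ϱ u = m := by
  have h : ∀ u : EuclideanSpace ℝ (Fin p), (m + ∑ j, a j * u j) * ϱ u
      = m * ϱ u + ∑ j, a j * (u j * ϱ u) := fun u => by
    rw [add_mul, Finset.sum_mul]; simp only [mul_assoc]
  simp only [h]
  rw [integral_add (hϱ.integrable.const_mul m)
    (integrable_finsetSum _ fun j _ => (hϱ.integrable_mean j).const_mul _),
    integral_finsetSum _ fun j _ => (hϱ.integrable_mean j).const_mul _]
  simp [integral_const_mul, hϱ.integral_eq_one, hϱ.mean]

theorem IsNormalisedDensity.integral_linear_mul_linear {ϱ : EuclideanSpace ℝ (Fin p) → ℝ}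
    (hϱ : IsNormalisedDensity ϱ) (a b : Fin p → ℝ) :
    ∫ u, (∑ j, a j * u j) * (∑ j, b j * u j) * ϱ u = ∑ j, a j * b j := by
  have h : ∀ u : EuclideanSpace ℝ (Fin p), (∑ j, a j * u j) * (∑ j, b j * u j) * ϱ u
      = ∑ i, ∑ j, a i * b j * (u i * u j * ϱ u) := fun u => by
    rw [Finset.sum_mul_sum, Finset.sum_mul]
    refine Finset.sum_congr rfl fun i _ => ?_
    rw [Finset.sum_mul]
    exact Finset.sum_congr rfl fun j _ => by ring
  simp only [h]
  rw [integral_finsetSum _ fun i _ =>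
    integrable_finsetSum _ fun j _ => (hϱ.integrable_cov i j).const_mul _]
  refine Finset.sum_congr rfl fun i _ => ?_
  rw [integral_finsetSum _ fun j _ => (hϱ.integrable_cov i j).const_mul _]
  simp [integral_const_mul, hϱ.cov, Matrix.one_apply]

/-- A normalised density has no nonzero period. -/
theorem IsNormalisedDensity.eq_of_shift_eq {ϱ : EuclideanSpace ℝ (Fin p) → ℝ}
    (hϱ : IsNormalisedDensity ϱ) {a b : EuclideanSpace ℝ (Fin p)}
    (h : ∀ u, ϱ (u - a) = ϱ (u - b)) : a = b := by
  ext i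
  -- Translating a density by `d` moves its mean from `0` to `d`.
  have key : ∀ d : EuclideanSpace ℝ (Fin p), ∫ u, u i * ϱ (u - d) = d i := fun d => by
    rw [← integral_add_right_eq_self _ d]
    have := hϱ.integral_add_linear (d i) (Pi.single i 1)
    simpa [Pi.single_apply, add_comm] using this
  rw [← key a, ← key b]
  simp only [h]

/-- The image of a normalised density under an injective affine map is, up to a factor, a
normalised density only if the map is an orthogonal one. -/
theorem IsNormalisedDensity.eq_zero_of_affine {ϱ ϱ' : EuclideanSpace ℝ (Fin p) → ℝ}
    (hϱ : IsNormalisedDensity ϱ) (hϱ' : IsNormalisedDensity ϱ') {M : Matrix (Fin p) (Fin p) ℝ}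
    (hM : Function.Injective M.toEuclideanLin) {m : EuclideanSpace ℝ (Fin p)} {J : ℝ}
    (h : ∀ u, ϱ' (m + M.toEuclideanLin u) * J = ϱ u) :
    m = 0 ∧ M ∈ Matrix.orthogonalGroup (Fin p) ℝ := by
  let A : EuclideanSpace ℝ (Fin p) →L[ℝ] EuclideanSpace ℝ (Fin p) :=
    LinearMap.toContinuousLinearMap M.toEuclideanLin
  have hinj : Function.Injective fun u => m + A u := fun u v huv => hM (add_left_cancel huv)
  have hsurj : Function.Surjective fun u => m + A u := fun v => by
    obtain ⟨u, hu⟩ := (LinearMap.injective_iff_surjective.1 hM) (v - m)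
    exact ⟨u, show m + M.toEuclideanLin u = v by rw [hu]; abel⟩
  have hcoord : ∀ u i, (m + A u) i = m i + ∑ j, M i j * u j := fun u i => by
    simp [A, Matrix.toLpLin_apply, Matrix.mulVec, dotProduct]
  -- Change of variables against a test function `q`. Taking `q` to be `1`, `v i` and `v i * v j`
  -- yields `J = |A.det|`, `m = 0` and `M * Mᵀ = 1` in turn.
  have hcv : ∀ q : EuclideanSpace ℝ (Fin p) → ℝ,
      J * ∫ v, q v * ϱ' v = |A.det| * ∫ u, q (m + A u) * ϱ u := fun q => by
    have := integral_image_eq_integral_abs_det_fderiv_smul volume MeasurableSet.univ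
      (f := fun u => m + A u) (f' := fun _ => A)
      (fun u _ => (A.hasFDerivAt.const_add m).hasFDerivWithinAt) hinj.injOn
      (fun v => q v * ϱ' v)
    rw [Set.image_univ, hsurj.range_eq, Measure.restrict_univ] at this
    rw [this, ← integral_const_mul, ← integral_const_mul]
    refine integral_congr_ae (.of_forall fun u => ?_)
    have hu : ϱ' (m + A u) * J = ϱ u := h u
    simp only [smul_eq_mul, ← hu]
    ring
  have hJ : J = |A.det| := by
    simpa [hϱ.integral_eq_one, hϱ'.integral_eq_one] using hcv fun _ => 1
  have hdet : |A.det| ≠ 0 := by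
    rw [← hJ]
    rintro rfl
    have : ∀ u, ϱ u = 0 := fun u => by rw [← h u, mul_zero]
    simpa [this] using hϱ.integral_eq_one
  have hm : m = 0 := by
    ext i
    have := hcv fun v => v i
    simp only [hcoord, hϱ.integral_add_linear, hϱ'.mean, mul_zero] at this
    simpa [hdet] using this.symm
  refine ⟨hm, ?_⟩
  rw [Matrix.mem_orthogonalGroup_iff]
  ext i j
  have := hcv fun v => v i * v j
  have hm0 : ∀ i, m i = 0 := fun i => by rw [hm, PiLp.zero_apply]
  simp only [hcoord, hm0, zero_add, hϱ.integral_linear_mul_linear, hϱ'.cov, hJ] at this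
  rw [mul_left_cancel₀ hdet this]
  simp [Matrix.mul_apply]

/-! ### Equivalence and orthogonal transformations -/

/-- Observationally equivalent parameter points differ by an orthogonal transformation. -/
theorem NVARParam.ObsEquiv.exists_orthogonal {θ θ' : NVARParam p k}
    (hobs : NVARParam.ObsEquiv θ' θ)
    (hf : ∀ i, ContDiff ℝ 1 (θ.f i)) (hf' : ∀ i, ContDiff ℝ 1 (θ'.f i))
    (hf0 : ∀ i, θ.f i 0 = 0) (hf0' : ∀ i, θ'.f i 0 = 0)
    (hs : Function.Surjective (θ.f 0)) (hs' : Function.Surjective (θ'.f 0))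
    (hdet : ∀ y, (fderiv ℝ (θ.f 0) y).det ≠ 0) (hdet' : ∀ y, (fderiv ℝ (θ'.f 0) y).det ≠ 0)
    (hϱ : IsNormalisedDensity θ.den) (hϱ' : IsNormalisedDensity θ'.den)
    (hsurj : Function.Surjective
      (fun z : Fin k → EuclideanSpace ℝ (Fin p) => ∑ i : Fin k, θ.f i.succ (z i)))
    {I₁ I₂ : Finset (Fin k)} (hdisj : Disjoint I₁ I₂)
    (hI₁ : SumJacobianFullRank (fun i => θ.f i.succ) I₁)
    (hI₂ : SumJacobianFullRank (fun i => θ.f i.succ) I₂) :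
    ∃ Υ ∈ Matrix.orthogonalGroup (Fin p) ℝ,
      θ'.c = Υ.toEuclideanLin θ.c ∧ ∀ i z, θ'.f i z = Υ.toEuclideanLin (θ.f i z) := by
  -- Equal lag sums in one model give equal conditional densities in both. Cancelling the Jacobian,
  -- and using that `f₀` is onto, two translates of the other model's shock density coincide.
  have hiff : ∀ x x' : Fin k → EuclideanSpace ℝ (Fin p),
      ∑ i, θ'.f i.succ (x i) = ∑ i, θ'.f i.succ (x' i) ↔
      ∑ i, θ.f i.succ (x i) = ∑ i, θ.f i.succ (x' i) := by
    intro x x'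
    constructor
    · intro hx
      refine add_left_cancel (a := θ.c) (hϱ.eq_of_shift_eq fun u => ?_)
      obtain ⟨y, rfl⟩ := hs u
      have h1 : θ'.condDensity x y = θ'.condDensity x' y := by
        simp only [condDensity, shock, hx]
      rw [hobs, hobs] at h1
      simpa only [sub_sub, condDensity, shock] using
        mul_right_cancel₀ (abs_ne_zero.2 (hdet y)) h1
    · intro hx
      refine add_left_cancel (a := θ'.c) (hϱ'.eq_of_shift_eq fun u => ?_)
      obtain ⟨y, rfl⟩ := hs' u
      have h1 : θ.condDensity x y = θ.condDensity x' y := by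
        simp only [condDensity, shock, hx]
      rw [← hobs, ← hobs] at h1
      simpa only [sub_sub, condDensity, shock] using
        mul_right_cancel₀ (abs_ne_zero.2 (hdet' y)) h1
  obtain ⟨σ, hσ⟩ := hsurj.hasRightInverse
  -- The choice of preimage `σ` is immaterial, by `hiff`.
  let φ : EuclideanSpace ℝ (Fin p) → EuclideanSpace ℝ (Fin p) := fun v => ∑ i, θ'.f i.succ (σ v i)
  have hφ : ∀ x : Fin k → EuclideanSpace ℝ (Fin p),
      φ (∑ i, θ.f i.succ (x i)) = ∑ i, θ'.f i.succ (x i) := fun x => (hiff _ _).2 (hσ _)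
  have hφ0 : φ 0 = 0 := by simpa [hf0, hf0'] using hφ 0
  obtain ⟨A, hA⟩ := exists_clm_of_sum_factors (g' := fun i => θ'.f i.succ)
    (fun i => hf i.succ) (fun i => hf' i.succ) hsurj hdisj hI₁ hI₂ hφ0 hφ
  obtain ⟨M, hM⟩ : ∃ M : Matrix (Fin p) (Fin p) ℝ, M.toEuclideanLin = A.toLinearMap :=
    Matrix.toEuclideanLin.surjective A.toLinearMap
  have hMA : ∀ v, M.toEuclideanLin v = φ v := fun v => by rw [hM, hA]; rfl
  have hinj : Function.Injective M.toEuclideanLin := by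
    intro a b hab
    obtain ⟨x, rfl⟩ := hsurj a
    obtain ⟨x', rfl⟩ := hsurj b
    simp only [hMA, hφ] at hab
    exact (hiff x x').1 hab
  have hmain : ∀ y, θ'.f 0 y - θ'.c - M.toEuclideanLin (θ.f 0 y - θ.c) = 0 ∧
      M ∈ Matrix.orthogonalGroup (Fin p) ℝ := fun y => by
    refine hϱ.eq_zero_of_affine hϱ' hinj
      (J := |(fderiv ℝ (θ'.f 0) y).det| / |(fderiv ℝ (θ.f 0) y).det|) fun u => ?_
    -- With `y` fixed, lags are chosen that make the shock equal to the prescribed `u`.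
    obtain ⟨x, hx⟩ := hsurj (θ.f 0 y - θ.c - u)
    have hu : u = θ.shock x y := by
      simp only at hx
      rw [shock, hx]; abel
    have hu' : θ'.f 0 y - θ'.c - M.toEuclideanLin (θ.f 0 y - θ.c) + M.toEuclideanLin u
        = θ'.shock x y := by
      rw [shock, ← hφ x, ← hMA, hu, shock, map_sub M.toEuclideanLin (θ.f 0 y - θ.c)]; abel
    rw [hu', hu, ← mul_div_assoc, div_eq_iff (abs_ne_zero.2 (hdet y))]
    exact hobs x y
  -- At `y = 0` both `f₀` terms vanish, which isolates the constants.
  have hc : θ'.c = M.toEuclideanLin θ.c := by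
    have := (hmain 0).1
    rw [hf0, hf0', zero_sub, zero_sub, map_neg, sub_neg_eq_add, neg_add_eq_zero] at this
    exact this
  refine ⟨M, (hmain 0).2, hc, fun i z => ?_⟩
  induction i using Fin.cases with
  | zero =>
    have := (hmain z).1
    rw [map_sub, hc, sub_sub_sub_cancel_right, sub_eq_zero] at this
    exact this
  | succ i =>
    have hsum : ∀ q : Fin (k + 1) → EuclideanSpace ℝ (Fin p) → EuclideanSpace ℝ (Fin p),
        (∀ j, q j 0 = 0) →
        ∑ j : Fin k, q j.succ ((Pi.single i z : Fin k → EuclideanSpace ℝ (Fin p)) j)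
          = q i.succ z := fun q hq => by
      rw [Finset.sum_eq_single i (fun j _ hj => by rw [Pi.single_eq_of_ne hj, hq]) (by simp),
        Pi.single_eq_same]
    -- Setting all other lags to `0`, where the functions vanish, isolates the `i`-th one.
    have := hφ (Pi.single i z)
    rw [hsum _ hf0, hsum _ hf0', ← hMA] at this
    exact this.symm

/-- An orthogonal transformation of a parameter point is observationally equivalent to it. -/
theorem NVARParam.obsEquiv_orthogonal {θ : NVARParam p k}
    (hf : Differentiable ℝ (θ.f 0)) {Υ : Matrix (Fin p) (Fin p) ℝ}
    (hΥ : Υ ∈ Matrix.orthogonalGroup (Fin p) ℝ) {c' : EuclideanSpace ℝ (Fin p)}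
    {f' : Fin (k + 1) → EuclideanSpace ℝ (Fin p) → EuclideanSpace ℝ (Fin p)}
    (hc : c' = Υ.toEuclideanLin θ.c) (hf' : ∀ i z, f' i z = Υ.toEuclideanLin (θ.f i z)) :
    NVARParam.ObsEquiv ⟨c', f', fun v => θ.den (Υ.transpose.toEuclideanLin v)⟩ θ := by
  intro x y
  have h1 : Υ.transpose * Υ = 1 := (Matrix.mem_orthogonalGroup_iff' _ _).1 hΥ
  have hinv : ∀ v, Υ.transpose.toEuclideanLin (Υ.toEuclideanLin v) = v := fun v => by
    ext i
    simp [Matrix.toLpLin_apply, h1]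
  have hshock : NVARParam.shock ⟨c', f', fun v => θ.den (Υ.transpose.toEuclideanLin v)⟩ x y
      = Υ.toEuclideanLin (θ.shock x y) := by
    simp only [shock, hc, hf', map_sub, map_sum]
  let U : EuclideanSpace ℝ (Fin p) →L[ℝ] EuclideanSpace ℝ (Fin p) :=
    LinearMap.toContinuousLinearMap Υ.toEuclideanLin
  have hder : fderiv ℝ (f' 0) y = U.comp (fderiv ℝ (θ.f 0) y) := by
    have : f' 0 = fun z => U (θ.f 0 z) := funext (hf' 0)
    rw [this]
    exact (U.hasFDerivAt.comp y (hf y).hasFDerivAt).fderiv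
  -- An orthogonal determinant may be `-1`; only its absolute value enters the conditional density.
  have hU : |U.det| = 1 := by
    have h2 : U.det = Υ.det := by
      change LinearMap.det Υ.toEuclideanLin = _
      rw [Matrix.toEuclideanLin_eq_toLin_orthonormal, LinearMap.det_toLin]
    have h3 := congrArg Matrix.det h1
    rw [Matrix.det_mul, Matrix.det_transpose, Matrix.det_one, mul_self_eq_one_iff] at h3
    rw [h2]
    rcases h3 with h3 | h3 <;> simp [h3]
  have hdet : (U.comp (fderiv ℝ (θ.f 0) y)).det = U.det * (fderiv ℝ (θ.f 0) y).det :=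
    LinearMap.det_comp _ _
  simp only [condDensity, hshock, hinv, hder, hdet, abs_mul, hU, one_mul]

end

theorem mainTheorem9 (p k : ℕ)
    (F : Fin (k + 1) → Set (EuclideanSpace ℝ (Fin p) → EuclideanSpace ℝ (Fin p)))
    (R : Set (EuclideanSpace ℝ (Fin p) → ℝ))
    -- restrictions on the whole parameter space
    (hsmooth : ∀ i, ∀ g ∈ F i, ContDiff ℝ 2 g ∧ g 0 = 0)
    (hbij : ∀ g ∈ F 0, Function.Bijective g ∧ ∀ z, 0 < (fderiv ℝ g z).det)
    (hdens : ∀ ϱ ∈ R, IsNormalisedDensity ϱ)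
    -- restrictions on the true parameter point only
    (θ : NVARParam p k) (hθ : θ ∈ NVARParam.space F R)
    (hsurj : Function.Surjective
      (fun z : Fin k → EuclideanSpace ℝ (Fin p) => ∑ i : Fin k, θ.f i.succ (z i)))
    (hjac : ∃ I₁ I₂ : Finset (Fin k), Disjoint I₁ I₂ ∧
      SumJacobianFullRank (fun i => θ.f i.succ) I₁ ∧
      SumJacobianFullRank (fun i => θ.f i.succ) I₂)
    (hscore : ∃ u : Fin (p + 1) → EuclideanSpace ℝ (Fin p), (∀ i, 0 < θ.den (u i)) ∧
      score θ.den (u 0) = 0 ∧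
      Submodule.span ℝ (Set.range fun i : Fin p => score θ.den (u i.succ)) = ⊤)
    -- the alternative parameters
    (c' : EuclideanSpace ℝ (Fin p))
    (f' : Fin (k + 1) → EuclideanSpace ℝ (Fin p) → EuclideanSpace ℝ (Fin p))
    (hf' : ∀ i, f' i ∈ F i) :
    ((∃ ϱ' ∈ R, NVARParam.ObsEquiv ⟨c', f', ϱ'⟩ θ) →
      ∃ Υ ∈ Matrix.orthogonalGroup (Fin p) ℝ,
        c' = Υ.toEuclideanLin θ.c ∧ ∀ i z, f' i z = Υ.toEuclideanLin (θ.f i z)) ∧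
    -- if `R` contains the density of every rotation `Υ u_t` of the true shock
    ((∀ Υ ∈ Matrix.orthogonalGroup (Fin p) ℝ,
        (fun v => θ.den (Υ.transpose.toEuclideanLin v)) ∈ R) →
      ((∃ ϱ' ∈ R, NVARParam.ObsEquiv ⟨c', f', ϱ'⟩ θ) ↔
        ∃ Υ ∈ Matrix.orthogonalGroup (Fin p) ℝ,
          c' = Υ.toEuclideanLin θ.c ∧ ∀ i z, f' i z = Υ.toEuclideanLin (θ.f i z))) := by
  have hiff : (∃ ϱ' ∈ R, NVARParam.ObsEquiv ⟨c', f', ϱ'⟩ θ) →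
      ∃ Υ ∈ Matrix.orthogonalGroup (Fin p) ℝ,
        c' = Υ.toEuclideanLin θ.c ∧ ∀ i z, f' i z = Υ.toEuclideanLin (θ.f i z) := by
    rintro ⟨ϱ', hϱ', hobs⟩
    obtain ⟨I₁, I₂, hdisj, hI₁, hI₂⟩ := hjac
    exact hobs.exists_orthogonal
      (fun i => (hsmooth i _ (hθ.1 i)).1.of_le one_le_two)
      (fun i => (hsmooth i _ (hf' i)).1.of_le one_le_two)
      (fun i => (hsmooth i _ (hθ.1 i)).2) (fun i => (hsmooth i _ (hf' i)).2)
      (hbij _ (hθ.1 0)).1.2 (hbij _ (hf' 0)).1.2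
      (fun y => ((hbij _ (hθ.1 0)).2 y).ne') (fun y => ((hbij _ (hf' 0)).2 y).ne')
      (hdens _ hθ.2) (hdens _ hϱ') hsurj hdisj hI₁ hI₂
  refine ⟨hiff, fun hR => ⟨hiff, ?_⟩⟩
  rintro ⟨Υ, hΥ, hc, hf⟩
  exact ⟨_, hR Υ hΥ, NVARParam.obsEquiv_orthogonal
    ((hsmooth 0 _ (hθ.1 0)).1.differentiable two_ne_zero) hΥ hc hf⟩
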